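/- Let $K$ be a field with a valuation $\nu$, let $\tilde\Gamma$ be a totally ordered abelian group, and let all valuations take values in $\tilde\Gamma\cup\{\infty\}$; valuations of $K[x]$ extend $\nu$ and take the value $\infty$ only at $0$. For a valuation $\mu$ of $K[x]$, say that $\phi$ $\mu$-divides $f$ if $\mu(f-h\phi)>\mu(f)$ for some $h\in K[x]$ (so $0$ is not $\mu$-divisible by any polynomial). A key polynomial for $\mu$ is a monic non-constant $\phi$ such that every $f$ that is $\mu$-divisible by $\phi$ has $\deg f\ge\deg\phi$, and such that $\phi$ $\mu$-divides $f$ or $g$ whenever it $\mu$-divides $fg$. If $\phi$ is a key polynomial for $\mu$ and $\gamma\in\tilde\Gamma$, $\gamma>\mu(\phi)$, the augmented valuation $[\mu;\phi,\gamma]$ sends $f=\sum_j g_j\phi^j$ (with $\deg g_j<\deg\phi$) to $\inf_j(\mu(g_j)+j\gamma)$. Let $A$ be a nonempty totally ordered set without greatest element, and let $\mathcal C=(\mu_\alpha)_{\alpha\in A}$ be a continuous admissible family of valuations of $K[x]$. This means that there are a valuation $\mu$ of $K[x]$, polynomials $\phi_\alpha$ all of the same degree, and values $\gamma_\alpha\in\tilde\Gamma$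 such that, for every $\alpha$, $\phi_\alpha$ is a key polynomial for $\mu$, $\gamma_\alpha>\mu(\phi_\alpha)$ and $\mu_\alpha=[\mu;\phi_\alpha,\gamma_\alpha]$, and such that, for all $\alpha<\beta$, $\phi_\beta$ is a key polynomial for $\mu_\alpha$, $\gamma_\beta>\gamma_\alpha=\mu_\alpha(\phi_\beta)$ and $\mu_\beta=[\mu_\alpha;\phi_\beta,\gamma_\beta]$. Let $\phi$ be a limit key polynomial for $\mathcal C$, i.e. a monic polynomial of minimal degree in $\{f : \mu_\alpha(f)<\mu_\beta(f)\ \text{for all } \alpha<\beta \text{ in } A\}$, and let $\gamma\in\tilde\Gamma$ satisfy $\gamma>\mu_\alpha(\phi)$ for all $\alpha\in A$. Say that $\phi$ $A$-divides $g$ if there is $\alpha\in A$ such that $\phi$ $\mu_\beta$-divides $g$ for all $\beta\ge\alpha$. Then for every $g\in K[x]$ that has degree $<\deg\phi$ or is not $A$-divisible by $\phi$, the supremum $\mu_A(g)=\sup_{\alpha\in A}\mu_\alpha(g)$ exists and $\mu_\alpha(g)=\mu_A(g)$ for all sufficiently large $\alpha$. Let $\mu'$ be the limit augmented valuation $[\mathcal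 C;\mu'(\phi)=\gamma]$, which sends $f=\sum_j g_j\phi^j$ (with $\deg g_j<\deg\phi$) to $\inf_j(\mu_A(g_j)+j\gamma)$. If $$f=f_m\phi^m+\dots+f_1\phi+f_0$$ with polynomials $f_0,\dots,f_m\in K[x]$ (of arbitrary degrees), none of which is $A$-divisible by $\phi$, then $$\mu'(f)=\inf_{0\le j\le m}\bigl(\mu_A(f_j)+j\gamma\bigr).$$ -/

import Mathlib

open Polynomial Filter

noncomputable section

namespace LimitAug

variable {K Γ A : Type*} [Field K] [AddCommGroup Γ] [LinearOrder Γ] [IsOrderedAddMonoid Γ]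

/-- `f` is `μ`-divisible by `φ`: some multiple `h φ` of `φ` is `μ`-equivalent to `f`,
that is `μ (f - h φ) > μ f`. (In particular `0` is not `μ`-divisible by any polynomial.) -/
def MuDvd (μ : AddValuation K[X] (WithTop Γ)) (φ f : K[X]) : Prop :=
  ∃ h : K[X], μ f < μ (f - h * φ)

/-- (MacLane) key polynomial for `μ`: monic, non-constant, `μ`-minimal and `μ`-irreducible. -/
structure IsKeyPolynomial (μ : AddValuation K[X] (WithTop Γ)) (φ : K[X]) : Prop where
  monic : φ.Monic
  natDegree_pos : 0 < φ.natDegree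
  minimal : ∀ f : K[X], MuDvd μ φ f → φ.natDegree ≤ f.natDegree
  irreducible : ∀ f g : K[X], MuDvd μ φ (f * g) → MuDvd μ φ f ∨ MuDvd μ φ g

/-- The coefficient `g_j`, with `deg g_j < deg φ`, in the expansion
`f = g_m φ ^ m + ⋯ + g_1 φ + g_0` of `f` in powers of a monic non-constant `φ`. -/
def digit (φ f : K[X]) (j : ℕ) : K[X] := (f /ₘ φ ^ j) %ₘ φ

/-- `Inf (w (g_j) + j γ)` over the expansion `f = ∑ g_j φ ^ j` with `deg g_j < deg φ`.
For `j > deg f` the coefficient `g_j` vanishes. -/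
def expansionInf (w : K[X] → WithTop Γ) (φ : K[X]) (γ : Γ) (f : K[X]) : WithTop Γ :=
  (Finset.range (f.natDegree + 1)).inf fun j => w (digit φ f j) + ((j • γ : Γ) : WithTop Γ)

/-- `μ' = [μ ; μ' φ = γ]` is the augmented valuation of `μ` associated with the key polynomial
`φ` of `μ` and the value `γ > μ φ`. -/
structure IsAugmentation (μ : AddValuation K[X] (WithTop Γ)) (φ : K[X]) (γ : Γ)
    (μ' : AddValuation K[X] (WithTop Γ)) : Prop where
  key : IsKeyPolynomial μ φ
  lt : μ φ < (γ : WithTop Γ)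
  apply_eq : ∀ f : K[X], μ' f = expansionInf μ φ γ f

/-- A continuous admissible family `(μ_α)` of valuations of `K[X]` extending `ν`, indexed by a
totally ordered set `A`, with base valuation `base`, key polynomials `key α` and values `γ α`.
(`A` is required to be nonempty and without greatest element in the theorem.)
That every `val α` extends `ν` and takes the value `∞` only at `0` follows from the same
properties of `base`. -/
structure ContinuousFamily (ν : AddValuation K (WithTop Γ)) (A : Type*) [LinearOrder A] where
  /-- the given valuation `μ` -/
  base : AddValuation K[X] (WithTop Γ)
  base_extends : ∀ a : K, base (C a) = ν a
  /-- `base` is a valuation, not only a pseudo-valuation -/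
  base_eq_top : ∀ f : K[X], base f = ⊤ → f = 0
  /-- the valuations `μ_α` -/
  val : A → AddValuation K[X] (WithTop Γ)
  /-- the key polynomials `φ_α` -/
  key : A → K[X]
  /-- the values `γ_α` -/
  γ : A → Γ
  natDegree_key : ∀ α β : A, (key α).natDegree = (key β).natDegree
  val_base : ∀ α : A, IsAugmentation base (key α) (γ α) (val α)
  val_step : ∀ α β : A, α < β → IsAugmentation (val α) (key β) (γ β) (val β)
  val_key : ∀ α β : A, α < β → val α (key β) = (γ α : WithTop Γ)
  γ_lt : ∀ α β : A, α < β → γ α < γ β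

namespace ContinuousFamily

variable [LinearOrder A] {ν : AddValuation K (WithTop Γ)} (F : ContinuousFamily ν A)

/-- The polynomials whose values `μ_α f` are strictly increasing in `α`. -/
def increasing : Set K[X] := {f | ∀ α β : A, α < β → F.val α f < F.val β f}

/-- Limit key polynomial: a monic polynomial of minimal degree in `F.increasing`. -/
structure IsLimitKeyPolynomial (φ : K[X]) : Prop where
  monic : φ.Monic
  mem : φ ∈ F.increasing
  minimal : ∀ f ∈ F.increasing, φ.natDegree ≤ f.natDegree

/-- `φ` `A`-divides `f`: it `μ_β`-divides `f` for all sufficiently large `β`. -/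
def ADvd (φ f : K[X]) : Prop := ∃ α : A, ∀ β : A, α ≤ β → MuDvd (F.val β) φ f

open Classical in
/-- The value `μ_A f`, the eventual value of `α ↦ μ_α f`; it is meaningful only where this map
is eventually constant (otherwise the default is `∞`). -/
def limVal (f : K[X]) : WithTop Γ :=
  if h : ∃ v : WithTop Γ, ∀ᶠ α in (atTop : Filter A), F.val α f = v then h.choose else ⊤

/-- The limit augmented valuation `[(μ_α) ; μ' φ = γ]`, as a function on `K[X]`. -/
def limitAugmentation (φ : K[X]) (γ : Γ) : K[X] → WithTop Γ :=
  expansionInf F.limVal φ γ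

end ContinuousFamily

end LimitAug

end

/-! Values along the family stabilise: if `f` has equal values at two indices `α < β`, its value is
constant from `α` on (`val_eq_of_val_eq`). So a polynomial outside `increasing` has a limit value;
members of `increasing` are `A`-divisible by `φ`. Division by `φ` is compatible with these values
(`eventually_le_val_digit`): each term of the expansion of `g` eventually has value at least that of
`g`. If `φ` does not `A`-divide `g`, then `g` and its remainder have the same limit value
(`limVal_modByMonic`). Let `M` be the infimum on the right of the formula. Expanding every `f j * φ
^ j` and adding digits gives `M` as a lower bound. For equality, take the smallest `i` attaining
`M`: in the `i`-th digit of the sum, the part from `f i` gives exactly `M`, smaller indices give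
more, larger ones contribute zero. -/

namespace LimitAug

variable {K Γ A : Type*} [Field K] [AddCommGroup Γ] [LinearOrder Γ]

/-! ### Expansions in powers of a monic polynomial -/

lemma natDegree_lt_of_degree_lt {f g : K[X]} (h : f.degree < g.degree) (hg : 0 < g.natDegree) :
    f.natDegree < g.natDegree := by
  rcases eq_or_ne f 0 with rfl | hf
  · simpa using hg
  · exact natDegree_lt_natDegree hf h

lemma digit_zero_right (φ f : K[X]) : digit φ f 0 = f %ₘ φ := by
  simp [digit]

lemma degree_digit_lt {φ : K[X]} (hφ : φ.Monic) (f : K[X]) (j : ℕ) :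
    (digit φ f j).degree < φ.degree :=
  degree_modByMonic_lt _ hφ

lemma divByMonic_pow_succ {φ : K[X]} (hφ : φ.Monic) (f : K[X]) (j : ℕ) :
    f /ₘ φ ^ (j + 1) = f /ₘ φ /ₘ φ ^ j := by
  have hj : (φ ^ j).Monic := hφ.pow j
  refine (div_modByMonic_unique (f /ₘ φ /ₘ φ ^ j)
    (f %ₘ φ + φ * ((f /ₘ φ) %ₘ φ ^ j)) (hφ.pow (j + 1)) ⟨?_, ?_⟩).1
  · conv_rhs => rw [← modByMonic_add_div f φ, ← modByMonic_add_div (f /ₘ φ) (φ ^ j)]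
    ring
  · have h1 : (f %ₘ φ).degree < (φ ^ (j + 1)).degree := by
      refine (degree_modByMonic_lt f hφ).trans_le ?_
      exact degree_le_of_dvd (dvd_pow_self φ j.succ_ne_zero) (hφ.pow (j + 1)).ne_zero
    have h2 : (φ * ((f /ₘ φ) %ₘ φ ^ j)).degree < (φ ^ (j + 1)).degree := by
      rw [pow_succ', degree_mul, degree_mul]
      have h3 := degree_modByMonic_lt (f /ₘ φ) hj
      rw [degree_eq_natDegree hφ.ne_zero]
      exact WithBot.add_lt_add_left (WithBot.coe_ne_bot) h3
    exact (degree_add_le _ _).trans_lt (max_lt h1 h2)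

lemma digit_succ {φ : K[X]} (hφ : φ.Monic) (f : K[X]) (j : ℕ) :
    digit φ f (j + 1) = digit φ (f /ₘ φ) j := by
  rw [digit, digit, divByMonic_pow_succ hφ]

lemma digit_zero_left (φ : K[X]) (j : ℕ) : digit φ 0 j = 0 := by
  simp [digit]

lemma digit_add (φ f g : K[X]) (j : ℕ) :
    digit φ (f + g) j = digit φ f j + digit φ g j := by
  have h : (f + g) /ₘ φ ^ j = f /ₘ φ ^ j + g /ₘ φ ^ j := by
    by_cases hm : (φ ^ j).Monic
    · refine (div_modByMonic_unique _ (f %ₘ φ ^ j + g %ₘ φ ^ j) hm ⟨?_, ?_⟩).1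
      · conv_rhs => rw [← modByMonic_add_div f (φ ^ j), ← modByMonic_add_div g (φ ^ j)]
        ring
      · exact (degree_add_le _ _).trans_lt
          (max_lt (degree_modByMonic_lt f hm) (degree_modByMonic_lt g hm))
    · simp [divByMonic_eq_of_not_monic _ hm]
  rw [digit, h, add_modByMonic, digit, digit]

lemma digit_sum {ι : Type*} (φ : K[X]) (s : Finset ι) (f : ι → K[X]) (j : ℕ) :
    digit φ (∑ i ∈ s, f i) j = ∑ i ∈ s, digit φ (f i) j := by
  classical
  induction s using Finset.induction_on with
  | empty => simp [digit_zero_left]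
  | insert a s ha ih => rw [Finset.sum_insert ha, Finset.sum_insert ha, digit_add, ih]

lemma digit_mul_pow_of_lt {φ : K[X]} (hφ : φ.Monic) (f : K[X]) {i k : ℕ} (hik : k < i) :
    digit φ (f * φ ^ i) k = 0 := by
  obtain ⟨d, rfl⟩ := Nat.exists_eq_add_of_lt hik
  have h : f * φ ^ (k + d + 1) = φ ^ k * (φ * (f * φ ^ d)) := by ring
  rw [digit, h, mul_divByMonic_cancel_left _ (hφ.pow k), self_mul_modByMonic hφ]

lemma digit_mul_pow_add {φ : K[X]} (hφ : φ.Monic) (f : K[X]) (i k : ℕ) :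
    digit φ (f * φ ^ i) (i + k) = digit φ f k := by
  induction i with
  | zero => simp
  | succ i ih =>
    have h : f * φ ^ (i + 1) = φ * (f * φ ^ i) := by ring
    rw [add_right_comm, digit_succ hφ, h, mul_divByMonic_cancel_left _ hφ, ih]

lemma digit_eq_zero {φ : K[X]} (hφ : φ.Monic) (hd : 0 < φ.natDegree) {f : K[X]} {j : ℕ}
    (hj : f.natDegree < j) : digit φ f j = 0 := by
  have h : f /ₘ φ ^ j = 0 := by
    rw [divByMonic_eq_zero_iff (hφ.pow j)]
    refine degree_lt_degree (hj.trans_le ?_)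
    rw [hφ.natDegree_pow]
    exact Nat.le_mul_of_pos_right j hd
  simp [digit, h]

lemma le_expansionInf {w : K[X] → WithTop Γ} {φ : K[X]} {γ : Γ} {f : K[X]} {c : WithTop Γ}
    (h : ∀ j, c ≤ w (digit φ f j) + ((j • γ : Γ) : WithTop Γ)) :
    c ≤ expansionInf w φ γ f :=
  Finset.le_inf fun j _ => h j

variable [IsOrderedAddMonoid Γ]

/-- Digits beyond the degree vanish and contribute `⊤`, so the truncation of the infimum never
matters. -/
lemma expansionInf_le {w : K[X] → WithTop Γ} (hw : w 0 = ⊤) {φ : K[X]} (hφ : φ.Monic)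
    (hd : 0 < φ.natDegree) (γ : Γ) (f : K[X]) (j : ℕ) :
    expansionInf w φ γ f ≤ w (digit φ f j) + ((j • γ : Γ) : WithTop Γ) := by
  rcases lt_or_ge f.natDegree j with h | h
  · simp [digit_eq_zero hφ hd h, hw]
  · exact Finset.inf_le (Finset.mem_range.2 (Nat.lt_succ_of_le h))

/-! ### Key polynomials and augmentations -/

section Augmentation

variable {μ μ' : AddValuation K[X] (WithTop Γ)} {φ : K[X]} {γ : Γ}

lemma val_mul_divByMonic_ge {f : K[X]} (h : μ f ≤ μ (f %ₘ φ)) :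
    μ f ≤ μ (f /ₘ φ) + μ φ := by
  have h' : f /ₘ φ * φ = f - f %ₘ φ := by
    rw [eq_sub_iff_add_eq, mul_comm, add_comm, modByMonic_add_div]
  rw [← μ.map_mul, h']
  exact μ.map_le_sub le_rfl h

/-- Otherwise `f` is the remainder plus a multiple of `φ` with larger value than the remainder, so
`φ` would `μ`-divide a polynomial of smaller degree. -/
lemma IsKeyPolynomial.le_val_modByMonic (hφ : IsKeyPolynomial μ φ) (f : K[X]) :
    μ f ≤ μ (f %ₘ φ) := by
  by_contra! h
  have hdvd : MuDvd μ φ (f %ₘ φ) := by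
    refine ⟨-(f /ₘ φ), ?_⟩
    rwa [neg_mul, sub_neg_eq_add, mul_comm, modByMonic_add_div]
  have h1 := hφ.minimal _ hdvd
  have h2 := natDegree_modByMonic_lt f hφ.monic
    (fun h => by simpa [h] using hφ.natDegree_pos)
  omega

lemma IsKeyPolynomial.le_val_digit (hφ : IsKeyPolynomial μ φ) (f : K[X]) (j : ℕ) :
    μ f ≤ μ (digit φ f j) + j • μ φ := by
  induction j generalizing f with
  | zero => simpa [digit_zero_right] using hφ.le_val_modByMonic f
  | succ j ih =>
    rw [digit_succ hφ.monic, succ_nsmul, ← add_assoc]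
    refine (val_mul_divByMonic_ge (hφ.le_val_modByMonic f)).trans ?_
    gcongr
    exact ih _

namespace IsAugmentation

lemma le_val_add (h : IsAugmentation μ φ γ μ') (f : K[X]) (j : ℕ) :
    μ' f ≤ μ (digit φ f j) + ((j • γ : Γ) : WithTop Γ) := by
  rw [h.apply_eq]
  exact expansionInf_le μ.map_zero h.key.monic h.key.natDegree_pos γ f j

lemma val_le (h : IsAugmentation μ φ γ μ') (f : K[X]) : μ f ≤ μ' f := by
  rw [h.apply_eq]
  refine le_expansionInf fun j => (h.key.le_val_digit f j).trans ?_
  rw [WithTop.coe_nsmul]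
  gcongr
  exact h.lt.le

lemma val_eq_of_not_muDvd (h : IsAugmentation μ φ γ μ') {f : K[X]}
    (hf : ¬ MuDvd μ φ f) : μ' f = μ f := by
  refine le_antisymm ?_ (h.val_le f)
  have h1 : μ' f ≤ μ (f %ₘ φ) := by
    simpa [digit_zero_right] using h.le_val_add f 0
  refine h1.trans (not_lt.1 fun h2 => hf ⟨f /ₘ φ, ?_⟩)
  rwa [mul_comm, ← modByMonic_eq_sub_mul_div]

lemma val_eq_of_natDegree_lt (h : IsAugmentation μ φ γ μ') {f : K[X]}
    (hf : f.natDegree < φ.natDegree) : μ' f = μ f :=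
  h.val_eq_of_not_muDvd fun hd => (h.key.minimal f hd).not_gt hf

lemma val_key (h : IsAugmentation μ φ γ μ') : μ' φ = (γ : WithTop Γ) := by
  have h1 : digit φ φ 1 = 1 := by
    have := digit_mul_pow_add h.key.monic (1 : K[X]) 1 0
    rw [one_mul, pow_one, add_zero, digit_zero_right] at this
    rw [this, (modByMonic_eq_self_iff h.key.monic).2]
    exact degree_lt_degree (by simpa using h.key.natDegree_pos)
  refine le_antisymm (by simpa [h1] using h.le_val_add φ 1) ?_
  rw [h.apply_eq]
  refine le_expansionInf fun j => ?_
  obtain rfl | hj := eq_or_ne j 1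
  · simp [h1]
  · have h2 : digit φ φ j = 0 := by
      rcases Nat.lt_or_gt_of_ne hj with hj | hj
      · simpa using digit_mul_pow_of_lt h.key.monic (1 : K[X]) hj
      · obtain ⟨k, rfl⟩ := Nat.exists_eq_add_of_lt hj
        have := digit_mul_pow_add h.key.monic (1 : K[X]) 1 (k + 1)
        rw [one_mul, pow_one, ← add_assoc] at this
        rw [this]
        exact digit_eq_zero h.key.monic h.key.natDegree_pos (by simp)
    simp [h2]

end IsAugmentation

/-- A polynomial `μ`-divisible by `φ` has larger `μ'`-value, for every `μ' ≥ μ` with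
`μ' φ > μ φ`. -/
lemma MuDvd.val_lt {f : K[X]} (hle : ∀ g, μ g ≤ μ' g) (hφ : μ φ < μ' φ) (hf : MuDvd μ φ f) :
    μ f < μ' f := by
  obtain ⟨q, hq⟩ := hf
  have h1 : μ (q * φ) = μ f := by
    have h := μ.map_sub_eq_of_lt_left hq
    rwa [sub_sub_cancel] at h
  have hne : μ q ≠ ⊤ := fun ht => by
    rw [μ.map_mul, ht, top_add] at h1
    exact not_top_lt (h1 ▸ hq)
  have h2 : μ f < μ' (q * φ) := by
    rw [← h1, μ.map_mul, μ'.map_mul]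
    exact (WithTop.add_lt_add_left hne hφ).trans_le (by gcongr; exact hle q)
  have h3 := μ'.map_lt_add (hq.trans_le (hle _)) h2
  rwa [sub_add_cancel] at h3

/-- Replacing `φ` by `φ'` changes `f - q * φ` only by `q * (φ - φ')`, whose value also exceeds `μ
f`. -/
lemma MuDvd.congr {φ' f : K[X]} (hφ : μ φ < μ (φ - φ')) (hf : MuDvd μ φ f) :
    MuDvd μ φ' f := by
  obtain ⟨q, hq⟩ := hf
  have h1 : μ (q * φ) = μ f := by
    have h := μ.map_sub_eq_of_lt_left hq
    rwa [sub_sub_cancel] at h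
  have hne : μ q ≠ ⊤ := fun ht => by
    rw [μ.map_mul, ht, top_add] at h1
    exact not_top_lt (h1 ▸ hq)
  refine ⟨q, ?_⟩
  have h2 : μ f < μ (q * (φ - φ')) := by
    rw [← h1, μ.map_mul, μ.map_mul]
    exact WithTop.add_lt_add_left hne hφ
  have h3 := μ.map_lt_add hq h2
  rwa [show f - q * φ + q * (φ - φ') = f - q * φ' by ring] at h3

end Augmentation

/-! ### Continuous families -/

namespace ContinuousFamily

variable [LinearOrder A] {ν : AddValuation K (WithTop Γ)} (F : ContinuousFamily ν A)

lemma val_mono (f : K[X]) : Monotone fun α => F.val α f := by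
  intro α β h
  rcases h.eq_or_lt with rfl | h
  · exact le_rfl
  · exact (F.val_step α β h).val_le f

lemma val_key_self (α : A) : F.val α (F.key α) = (F.γ α : WithTop Γ) :=
  (F.val_base α).val_key

/-- The leading terms cancel, so the difference has the same value at `α` and at `β`; at `β` it is
at least `γ β > γ α`. -/
lemma val_key_lt_val_key_sub {α β δ : A} (hαβ : α < β) (hβδ : β < δ) :
    F.val α (F.key δ) < F.val α (F.key δ - F.key β) := by
  have hβ := (F.val_step α β hαβ).key
  have hδ := (F.val_step α δ (hαβ.trans hβδ)).key
  have hdeg : (F.key δ - F.key β).natDegree < (F.key β).natDegree := by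
    have hd : (F.key δ).degree = (F.key β).degree := by
      rw [degree_eq_natDegree hδ.monic.ne_zero, F.natDegree_key δ β,
        ← degree_eq_natDegree hβ.monic.ne_zero]
    have h := degree_sub_lt_left hd hδ.monic.ne_zero
      (hδ.monic.leadingCoeff.trans hβ.monic.leadingCoeff.symm)
    exact natDegree_lt_of_degree_lt (hd ▸ h) hβ.natDegree_pos
  rw [F.val_key α δ (hαβ.trans hβδ), ← (F.val_step α β hαβ).val_eq_of_natDegree_lt hdeg]
  refine (WithTop.coe_lt_coe.2 (F.γ_lt α β hαβ)).trans_le ?_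
  exact (F.val β).map_le_sub (F.val_key β δ hβδ).ge (F.val_key_self β).ge

lemma val_eq_of_val_eq {α β : A} (hαβ : α < β) {f : K[X]} (h : F.val α f = F.val β f)
    {δ : A} (hδ : α ≤ δ) : F.val δ f = F.val α f := by
  rcases le_or_gt δ β with h' | h'
  · exact le_antisymm (h ▸ F.val_mono f h') (F.val_mono f hδ)
  -- A rise from `α` to `δ` would make `key δ`, hence the equivalent `key β`, divide `f` at `α`,
  -- forcing a rise from `α` to `β`.
  · refine (F.val_step α δ (hαβ.trans h')).val_eq_of_not_muDvd fun hd => ?_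
    have hd' := hd.congr (F.val_key_lt_val_key_sub hαβ h')
    refine (hd'.val_lt (F.val_mono · hαβ.le) ?_).ne h
    rw [F.val_key_self]
    exact (F.val_step α β hαβ).lt

/-- The value `F.val α f` is eventually constant in `α`. -/
lemma exists_val_eq {f : K[X]} (hf : f ∉ F.increasing) :
    ∃ α, ∀ β, α ≤ β → F.val β f = F.val α f := by
  simp only [increasing, Set.mem_ofPred_eq, not_forall, not_lt] at hf
  obtain ⟨α, β, hαβ, h⟩ := hf
  exact ⟨α, fun δ hδ => F.val_eq_of_val_eq hαβ (le_antisymm (F.val_mono f hαβ.le) h) hδ⟩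

/-! ### Limit values -/

section limVal

variable [Nonempty A]

lemma limVal_eq {f : K[X]} {v : WithTop Γ} (h : ∀ᶠ α in (atTop : Filter A), F.val α f = v) :
    F.limVal f = v := by
  have hex : ∃ v : WithTop Γ, ∀ᶠ α in (atTop : Filter A), F.val α f = v := ⟨v, h⟩
  rw [limVal, dif_pos hex]
  obtain ⟨α, h1, h2⟩ := (hex.choose_spec.and h).exists
  exact h1.symm.trans h2

lemma limVal_zero : F.limVal 0 = ⊤ :=
  F.limVal_eq (Eventually.of_forall fun α => (F.val α).map_zero)

lemma eventually_val_eq {f : K[X]} (hf : f ∉ F.increasing) :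
    ∀ᶠ α in (atTop : Filter A), F.val α f = F.limVal f := by
  obtain ⟨α, hα⟩ := F.exists_val_eq hf
  have h : ∀ᶠ β in (atTop : Filter A), F.val β f = F.val α f := eventually_atTop.2 ⟨α, hα⟩
  rwa [F.limVal_eq h]

lemma isLUB_limVal {f : K[X]} (hf : f ∉ F.increasing) :
    IsLUB (Set.range fun α : A => F.val α f) (F.limVal f) := by
  have h := F.eventually_val_eq hf
  constructor
  · rintro _ ⟨α, rfl⟩
    obtain ⟨β, h1, h2⟩ := (h.and (eventually_ge_atTop α)).exists
    exact h1 ▸ F.val_mono f h2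
  · intro b hb
    obtain ⟨β, h1⟩ := h.exists
    exact h1 ▸ hb ⟨β, rfl⟩

lemma aDvd_of_eventually_val_lt {φ f : K[X]}
    (h : ∀ᶠ β in (atTop : Filter A), F.val β f < F.val β (f %ₘ φ)) : F.ADvd φ f := by
  obtain ⟨α, hα⟩ := eventually_atTop.1 h
  refine ⟨α, fun β hβ => ⟨f /ₘ φ, ?_⟩⟩
  rw [mul_comm, ← modByMonic_eq_sub_mul_div]
  exact hα β hβ

end limVal

/-! ### Limit key polynomials and the expansion formula -/

namespace IsLimitKeyPolynomial

variable {F} [Nonempty A] [NoMaxOrder A] {φ : K[X]}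
lemma natDegree_pos (hφ : F.IsLimitKeyPolynomial φ) : 0 < φ.natDegree := by
  by_contra h
  obtain rfl := hφ.monic.natDegree_eq_zero.1 (by omega)
  obtain ⟨α⟩ := ‹Nonempty A›
  obtain ⟨β, hβ⟩ := exists_gt α
  have := hφ.mem α β hβ
  simp at this

lemma notMem_of_degree_lt (hφ : F.IsLimitKeyPolynomial φ)
    {g : K[X]} (hg : g.degree < φ.degree) : g ∉ F.increasing := fun h =>
  (hφ.minimal g h).not_gt
    (natDegree_lt_of_degree_lt hg hφ.natDegree_pos)

lemma digit_notMem (hφ : F.IsLimitKeyPolynomial φ)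
    (f : K[X]) (j : ℕ) : digit φ f j ∉ F.increasing :=
  hφ.notMem_of_degree_lt (degree_digit_lt hφ.monic f j)

/-- If the stabilised remainder had smaller value than `f`, the product `(f /ₘ φ) * φ` would have
that same constant value from there on, although the values of `φ` strictly increase. -/
lemma eventually_le_val_modByMonic (hφ : F.IsLimitKeyPolynomial φ) (f : K[X]) :
    ∀ᶠ β in (atTop : Filter A), F.val β f ≤ F.val β (f %ₘ φ) := by
  have hr := hφ.digit_notMem f 0
  rw [digit_zero_right] at hr
  obtain ⟨α, hα⟩ := F.exists_val_eq hr
  filter_upwards [eventually_ge_atTop α] with β hβ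
  by_contra! h
  have hval : ∀ δ, β ≤ δ → F.val δ (f /ₘ φ) + F.val δ φ = F.val β (f %ₘ φ) := by
    intro δ hδ
    have h1 : F.val δ (f %ₘ φ) = F.val β (f %ₘ φ) := by rw [hα δ (hβ.trans hδ), hα β hβ]
    have h2 : F.val δ (f %ₘ φ) < F.val δ f := h1 ▸ h.trans_le (F.val_mono f hδ)
    have h3 := (F.val δ).map_sub_eq_of_lt_right h2
    rw [← h1, ← h3, ← (F.val δ).map_mul]
    congr 1
    rw [eq_sub_iff_add_eq, mul_comm, add_comm, modByMonic_add_div]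
  obtain ⟨δ, hδ⟩ := exists_gt β
  have hβ' := hval β le_rfl
  refine absurd (hβ'.trans (hval δ hδ.le).symm) (ne_of_lt ?_)
  have hne : F.val β (f /ₘ φ) ≠ ⊤ := fun ht => by
    rw [ht, top_add] at hβ'
    exact not_top_lt (hβ' ▸ h)
  exact (WithTop.add_lt_add_left hne (hφ.mem β δ hδ)).trans_le
    (by gcongr; exact F.val_mono _ hδ.le)

lemma eventually_le_val_digit (hφ : F.IsLimitKeyPolynomial φ) (f : K[X]) (j : ℕ) :
    ∀ᶠ β in (atTop : Filter A), F.val β f ≤ F.val β (digit φ f j) + j • F.val β φ := by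
  induction j generalizing f with
  | zero => simpa [digit_zero_right] using hφ.eventually_le_val_modByMonic f
  | succ j ih =>
    filter_upwards [ih (f /ₘ φ), hφ.eventually_le_val_modByMonic f] with β h1 h2
    rw [digit_succ hφ.monic, succ_nsmul, ← add_assoc]
    refine (val_mul_divByMonic_ge h2).trans ?_
    gcongr

lemma aDvd_of_mem (hφ : F.IsLimitKeyPolynomial φ)
    {f : K[X]} (hf : f ∈ F.increasing) : F.ADvd φ f := by
  have hr := hφ.digit_notMem f 0
  rw [digit_zero_right] at hr
  obtain ⟨α, hα⟩ := F.exists_val_eq hr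
  refine F.aDvd_of_eventually_val_lt ?_
  obtain ⟨α', hα'⟩ := eventually_atTop.1 (hφ.eventually_le_val_modByMonic f)
  filter_upwards [eventually_ge_atTop α, eventually_ge_atTop α'] with β hβ hβ'
  obtain ⟨δ, hδ⟩ := exists_gt β
  calc F.val β f < F.val δ f := hf β δ hδ
    _ ≤ F.val δ (f %ₘ φ) := hα' δ (hβ'.trans hδ.le)
    _ = F.val β (f %ₘ φ) := by rw [hα δ (hβ.trans hδ.le), hα β hβ]

lemma limVal_modByMonic (hφ : F.IsLimitKeyPolynomial φ) {g : K[X]} (hg : ¬ F.ADvd φ g) :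
    F.limVal (g %ₘ φ) = F.limVal g := by
  have hr := hφ.digit_notMem g 0
  rw [digit_zero_right] at hr
  have h1 := F.eventually_val_eq hr
  have h2 := F.eventually_val_eq (fun h => hg (hφ.aDvd_of_mem h))
  obtain ⟨β, hβ1, hβ2, hβ⟩ := (h1.and (h2.and (hφ.eventually_le_val_modByMonic g))).exists
  refine le_antisymm (not_lt.1 fun h => hg (F.aDvd_of_eventually_val_lt ?_)) ?_
  · filter_upwards [h1, h2] with β hβ1 hβ2
    rwa [hβ1, hβ2]
  · rwa [hβ1, hβ2] at hβ

lemma limVal_le_digit (hφ : F.IsLimitKeyPolynomial φ)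
    {γ : Γ} (hγ : ∀ α : A, F.val α φ < (γ : WithTop Γ)) {g : K[X]}
    (hg : ¬ F.ADvd φ g) (j : ℕ) :
    F.limVal g ≤ F.limVal (digit φ g j) + ((j • γ : Γ) : WithTop Γ) := by
  obtain ⟨β, h1, h2, h3⟩ := ((F.eventually_val_eq (hφ.digit_notMem g j)).and
    ((F.eventually_val_eq fun h => hg (hφ.aDvd_of_mem h)).and
      (hφ.eventually_le_val_digit g j))).exists
  rw [h1, h2] at h3
  refine h3.trans ?_
  rw [WithTop.coe_nsmul]
  gcongr
  exact (hγ β).le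

/-- Multiplication by `φ ^ i` shifts digits by `i`, adding `i • γ` to both sides. -/
lemma limVal_mul_pow_le_digit (hφ : F.IsLimitKeyPolynomial φ)
    {γ : Γ} (hγ : ∀ α : A, F.val α φ < (γ : WithTop Γ)) {g : K[X]}
    (hg : ¬ F.ADvd φ g) (i k : ℕ) :
    F.limVal g + ((i • γ : Γ) : WithTop Γ) ≤
      F.limVal (digit φ (g * φ ^ i) k) + ((k • γ : Γ) : WithTop Γ) := by
  rcases lt_or_ge k i with h | h
  · simp [digit_mul_pow_of_lt hφ.monic g h, F.limVal_zero]
  · obtain ⟨k, rfl⟩ := Nat.exists_eq_add_of_le h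
    rw [digit_mul_pow_add hφ.monic, add_nsmul, add_comm (i • γ), WithTop.coe_add, ← add_assoc]
    gcongr
    exact hφ.limVal_le_digit hγ hg k

lemma min_limVal_le_limVal_add (hφ : F.IsLimitKeyPolynomial φ)
    {a b : K[X]} (ha : a.degree < φ.degree) (hb : b.degree < φ.degree) :
    min (F.limVal a) (F.limVal b) ≤ F.limVal (a + b) := by
  obtain ⟨β, h1, h2, h3⟩ := ((F.eventually_val_eq (hφ.notMem_of_degree_lt ha)).and
    ((F.eventually_val_eq (hφ.notMem_of_degree_lt hb)).and (F.eventually_val_eq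
      (hφ.notMem_of_degree_lt ((degree_add_le a b).trans_lt (max_lt ha hb)))))).exists
  rw [← h1, ← h2, ← h3]
  exact (F.val β).map_add a b

lemma limVal_add_eq_of_lt (hφ : F.IsLimitKeyPolynomial φ)
    {a b : K[X]} (ha : a.degree < φ.degree) (hb : b.degree < φ.degree)
    (hab : F.limVal a < F.limVal b) : F.limVal (a + b) = F.limVal a := by
  refine F.limVal_eq ?_
  filter_upwards [F.eventually_val_eq (hφ.notMem_of_degree_lt ha),
    F.eventually_val_eq (hφ.notMem_of_degree_lt hb)] with β h1 h2
  rw [← h1, ← h2] at hab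
  rw [(F.val β).map_add_eq_of_lt_left hab, h1]

/-- A property of `w + c` closed under minima passes from the summands to the sum. -/
lemma limVal_sum_induction (hφ : F.IsLimitKeyPolynomial φ)
    {ι : Type*} (s : Finset ι) (p : ι → K[X]) (c : WithTop Γ)
    (P : WithTop Γ → Prop) (htop : P ⊤) (hmin : ∀ x y, P x → P y → P (min x y))
    (hmono : ∀ x y, x ≤ y → P x → P y) (hdeg : ∀ i ∈ s, (p i).degree < φ.degree)
    (hp : ∀ i ∈ s, P (F.limVal (p i) + c)) :
    (∑ i ∈ s, p i).degree < φ.degree ∧ P (F.limVal (∑ i ∈ s, p i) + c) := by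
  refine Finset.sum_induction p (fun q => q.degree < φ.degree ∧ P (F.limVal q + c)) ?_ ?_
    fun i hi => ⟨hdeg i hi, hp i hi⟩
  · rintro a b ⟨ha, ha'⟩ ⟨hb, hb'⟩
    refine ⟨(degree_add_le a b).trans_lt (max_lt ha hb), hmono _ _ ?_ (hmin _ _ ha' hb')⟩
    rw [min_add_add_right]
    gcongr
    exact hφ.min_limVal_le_limVal_add ha hb
  · refine ⟨?_, by simpa [F.limVal_zero] using htop⟩
    rw [degree_zero]
    exact bot_lt_iff_ne_bot.2 (degree_ne_bot.2 hφ.monic.ne_zero)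

theorem limitAugmentation_sum (hφ : F.IsLimitKeyPolynomial φ)
    {γ : Γ} (hγ : ∀ α : A, F.val α φ < (γ : WithTop Γ))
    (m : ℕ) (f : ℕ → K[X]) (hf : ∀ j ≤ m, ¬ F.ADvd φ (f j)) :
    F.limitAugmentation φ γ (∑ j ∈ Finset.range (m + 1), f j * φ ^ j) =
      (Finset.range (m + 1)).inf fun j => F.limVal (f j) + ((j • γ : Γ) : WithTop Γ) := by
  set t : ℕ → WithTop Γ := fun j => F.limVal (f j) + ((j • γ : Γ) : WithTop Γ) with ht
  set M := (Finset.range (m + 1)).inf t with hM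
  have hMle : ∀ j ∈ Finset.range (m + 1), M ≤ t j := fun j hj => Finset.inf_le hj
  have hdig : ∀ j ∈ Finset.range (m + 1), ∀ k, t j ≤
      F.limVal (digit φ (f j * φ ^ j) k) + ((k • γ : Γ) : WithTop Γ) := fun j hj k =>
    hφ.limVal_mul_pow_le_digit hγ (hf j (Nat.lt_succ_iff.1 (Finset.mem_range.1 hj))) j k
  have hge : M ≤ F.limitAugmentation φ γ (∑ j ∈ Finset.range (m + 1), f j * φ ^ j) := by
    refine le_expansionInf fun k => ?_
    rw [digit_sum]
    exact (hφ.limVal_sum_induction _ _ _ (M ≤ ·) le_top (fun x y => le_min)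
      (fun x y hxy hx => hx.trans hxy) (fun i _ => degree_digit_lt hφ.monic _ _)
      fun j hj => (hMle j hj).trans (hdig j hj k)).2
  refine le_antisymm ?_ hge
  -- Finiteness of `M` is needed below: vanishing digits have value `⊤`, which must be strictly
  -- above `M`.
  rcases eq_or_ne M ⊤ with hMtop | hMtop
  · rw [hMtop]; exact le_top
  have hex : ∃ j, j ∈ Finset.range (m + 1) ∧ t j = M := by
    obtain ⟨j, hj, h⟩ := Finset.exists_mem_eq_inf (Finset.range (m + 1)) ⟨0, by simp⟩ t
    exact ⟨j, hj, h.symm⟩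
  classical
  obtain ⟨i, ⟨hi, hti⟩, hmin⟩ : ∃ i, (i ∈ Finset.range (m + 1) ∧ t i = M) ∧
      ∀ j < i, ¬ (j ∈ Finset.range (m + 1) ∧ t j = M) :=
    ⟨Nat.find hex, Nat.find_spec hex, fun j hj => Nat.find_min hex hj⟩
  refine (expansionInf_le F.limVal_zero hφ.monic hφ.natDegree_pos γ _ i).trans ?_
  rw [digit_sum, ← Finset.add_sum_erase _ _ hi]
  -- All other contributions to digit `i` lie strictly above `M`, so they cannot cancel that of `f
  -- i`.
  obtain ⟨hdeg, hrest⟩ := hφ.limVal_sum_induction ((Finset.range (m + 1)).erase i)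
    (fun j => digit φ (f j * φ ^ j) i) ((i • γ : Γ) : WithTop Γ) (M < ·)
    (lt_top_iff_ne_top.2 hMtop) (fun x y => lt_min) (fun x y hxy hx => hx.trans_le hxy)
    (fun j _ => degree_digit_lt hφ.monic _ _) (by
      intro j hj
      obtain ⟨hji, hj⟩ := Finset.mem_erase.1 hj
      rcases Nat.lt_or_gt_of_ne hji with h | h
      · exact ((hMle j hj).lt_of_ne fun h' => hmin j h ⟨hj, h'.symm⟩).trans_le (hdig j hj i)
      · simpa [digit_mul_pow_of_lt hφ.monic (f j) h, F.limVal_zero] using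
          lt_top_iff_ne_top.2 hMtop)
  have hfirst : F.limVal (digit φ (f i * φ ^ i) i) = F.limVal (f i) := by
    have h := digit_mul_pow_add hφ.monic (f i) i 0
    rw [add_zero, digit_zero_right] at h
    rw [h, hφ.limVal_modByMonic (hf i (Nat.lt_succ_iff.1 (Finset.mem_range.1 hi)))]
  rw [hφ.limVal_add_eq_of_lt (degree_digit_lt hφ.monic _ _) hdeg ?_, hfirst]
  · exact hti.le
  · rw [hfirst]
    rw [← hti] at hrest
    exact lt_of_add_lt_add_right hrest

end IsLimitKeyPolynomial

end ContinuousFamily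

end LimitAug

theorem mainTheorem2 {K Γ A : Type*} [Field K]
    [AddCommGroup Γ] [LinearOrder Γ] [IsOrderedAddMonoid Γ]
    [LinearOrder A] [Nonempty A] [NoMaxOrder A]
    (ν : AddValuation K (WithTop Γ)) (F : LimitAug.ContinuousFamily ν A)
    (φ : K[X]) (hφ : F.IsLimitKeyPolynomial φ)
    (γ : Γ) (hγ : ∀ α : A, F.val α φ < (γ : WithTop Γ)) :
    -- `μ_A` is well defined on all polynomials to which it is applied
    (∀ g : K[X], (g.degree < φ.degree ∨ ¬ F.ADvd φ g) →
      IsLUB (Set.range fun α : A => F.val α g) (F.limVal g) ∧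
        ∀ᶠ α in (atTop : Filter A), F.val α g = F.limVal g) ∧
    -- the formula for the limit augmented valuation
    ∀ (m : ℕ) (f : ℕ → K[X]), (∀ j ≤ m, ¬ F.ADvd φ (f j)) →
      F.limitAugmentation φ γ (∑ j ∈ Finset.range (m + 1), f j * φ ^ j) =
        (Finset.range (m + 1)).inf fun j =>
          F.limVal (f j) + ((j • γ : Γ) : WithTop Γ) := by
  refine ⟨fun g hg => ?_, hφ.limitAugmentation_sum hγ⟩
  have hg' : g ∉ F.increasing :=
    hg.elim hφ.notMem_of_degree_lt fun h hmem => h (hφ.aDvd_of_mem hmem)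
  exact ⟨F.isLUB_limVal hg', F.eventually_val_eq hg'⟩
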